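/- Let $\mathbb{H}$ denote the quaternions with imaginary units $e_1,e_2,e_3$ (with $e_3=e_1e_2$), and let $L^2(\mathbb{R}^3,\mathbb{H})$ be the right quaternionic Hilbert space of (classes of) square-integrable functions $v:\mathbb{R}^3\to\mathbb{H}$. For a right $\mathbb{H}$-linear operator $T:\mathcal{D}(T)\subset V\to V$ on such a space $V$ and $s\in\mathbb{H}$ put \[ \mathcal{Q}_s(T) := T^2 - 2\,\mathrm{Re}(s)\,T + |s|^2\mathcal{I},\qquad \mathcal{D}(\mathcal{Q}_s(T)) = \mathcal{D}(T^2)=\{v\in\mathcal{D}(T): Tv\in\mathcal{D}(T)\}. \] The $S$-resolvent set $\rho_S(T)$ is the set of all $s\in\mathbb{H}$ for which $\mathcal{Q}_s(T)$ is a bijection from $\mathcal{D}(T^2)$ onto $V$ whose inverse is a bounded right linear operator on $V$, and the $S$-spectrum of $T$ is $\sigma_S(T):=\mathbb{H}\setminus\rho_S(T)$. Let $\nabla v := e_1\,\partial_{x_1}v + e_2\,\partial_{x_2}v + e_3\,\partial_{x_3}v$ be the quaternionic nabla operator on $L^2(\mathbb{R}^3,\mathbb{H})$, where the units multiply from the left,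 the derivatives are weak derivatives, and the domain is the Sobolev space $\mathcal{D}(\nabla)=H^1(\mathbb{R}^3,\mathbb{H})$ of all $v\in L^2(\mathbb{R}^3,\mathbb{H})$ whose weak partial derivatives $\partial_{x_1}v,\partial_{x_2}v,\partial_{x_3}v$ belong to $L^2(\mathbb{R}^3,\mathbb{H})$. **Theorem.** The $S$-spectrum of $\nabla$ as an operator on $L^2(\mathbb{R}^3,\mathbb{H})$ is exactly the set of real quaternions: \[ \sigma_S(\nabla) = \mathbb{R}. \] -/

import Mathlib

open MeasureTheory
open scoped ENNReal ContDiff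

noncomputable section

namespace QuaternionicNabla

/-! ### The S-spectrum

A right quaternionic vector space is a module over the opposite ring of `Quaternion ℝ`, so that
`MulOpposite.op a • v` is the right multiplication `v a`. A (possibly unbounded) right linear
operator is a partially defined map that is linear over that opposite ring. -/

section SSpectrum

variable {V : Type*} [NormedAddCommGroup V] [Module (Quaternion ℝ)ᵐᵒᵖ V] [NormedSpace ℝ V]
  [SMulCommClass (Quaternion ℝ)ᵐᵒᵖ ℝ V]

/-- The square `T²` of an unbounded right linear operator, with its natural domain
`{v ∈ D(T) : T v ∈ D(T)}`. -/
def sq (T : V →ₗ.[(Quaternion ℝ)ᵐᵒᵖ] V) : V →ₗ.[(Quaternion ℝ)ᵐᵒᵖ] V where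
  domain :=
    { carrier := {v | ∃ h : v ∈ T.domain, T ⟨v, h⟩ ∈ T.domain}
      zero_mem' := ⟨T.domain.zero_mem, by
        have h0 : T ⟨0, T.domain.zero_mem⟩ = 0 := T.map_zero
        rw [h0]
        exact T.domain.zero_mem⟩
      add_mem' := by
        rintro a b ⟨ha, ha'⟩ ⟨hb, hb'⟩
        refine ⟨T.domain.add_mem ha hb, ?_⟩
        have h0 : T ⟨a + b, T.domain.add_mem ha hb⟩ = T ⟨a, ha⟩ + T ⟨b, hb⟩ :=
          T.map_add ⟨a, ha⟩ ⟨b, hb⟩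
        rw [h0]
        exact T.domain.add_mem ha' hb'
      smul_mem' := by
        rintro c a ⟨ha, ha'⟩
        refine ⟨T.domain.smul_mem c ha, ?_⟩
        have h0 : T ⟨c • a, T.domain.smul_mem c ha⟩ = c • T ⟨a, ha⟩ := T.map_smul c ⟨a, ha⟩
        rw [h0]
        exact T.domain.smul_mem c ha' }
  toFun :=
    { toFun := fun v => T ⟨T ⟨v.1, v.2.choose⟩, v.2.choose_spec⟩
      map_add' := by
        intro a b
        rw [← T.map_add]
        congr 1
        apply Subtype.ext
        exact T.map_add ⟨a.1, a.2.choose⟩ ⟨b.1, b.2.choose⟩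
      map_smul' := by
        intro c a
        rw [RingHom.id_apply, ← T.map_smul]
        congr 1
        apply Subtype.ext
        exact T.map_smul c ⟨a.1, a.2.choose⟩ }

/-- The operator `Q_s(T) = T² - 2 Re(s) T + |s|² I`, with domain `D(T²)`. (The domain of a sum of
partially defined maps is the intersection of their domains.) -/
def Q (s : Quaternion ℝ) (T : V →ₗ.[(Quaternion ℝ)ᵐᵒᵖ] V) : V →ₗ.[(Quaternion ℝ)ᵐᵒᵖ] V :=
  sq T - (2 * s.re) • T + (‖s‖ ^ 2) • (LinearMap.id : V →ₗ[(Quaternion ℝ)ᵐᵒᵖ] V).toPMap ⊤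

/-- `A⁻¹ ∈ B(V)`: the operator `A` is a bijection from its domain onto `V`, and its inverse is a
bounded right linear operator on `V`. -/
def HasBoundedInverse (A : V →ₗ.[(Quaternion ℝ)ᵐᵒᵖ] V) : Prop :=
  ∃ B : V →L[(Quaternion ℝ)ᵐᵒᵖ] V,
    (∀ v : V, ∃ h : B v ∈ A.domain, A ⟨B v, h⟩ = v) ∧ ∀ u : A.domain, B (A u) = u

/-- The S-resolvent set `ρ_S(T)`. -/
def sResolventSet (T : V →ₗ.[(Quaternion ℝ)ᵐᵒᵖ] V) : Set (Quaternion ℝ) :=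
  {s | HasBoundedInverse (Q s T)}

/-- The S-spectrum `σ_S(T)`, the complement of `ρ_S(T)` in the quaternions. -/
def sSpectrum (T : V →ₗ.[(Quaternion ℝ)ᵐᵒᵖ] V) : Set (Quaternion ℝ) :=
  (sResolventSet T)ᶜ

end SSpectrum

/-! ### The nabla operator on `L²(ℝ³, ℍ)` -/

/-- The space `ℝ³`. -/
abbrev R3 : Type := EuclideanSpace ℝ (Fin 3)

/-- The space `L²(ℝ³, ℍ)` with respect to the Lebesgue measure. -/
abbrev L2H : Type := Lp (Quaternion ℝ) 2 (volume : Measure R3)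

/-- The derivative of `φ` in the direction of the `i`-th coordinate. -/
def partialDeriv (i : Fin 3) (φ : R3 → ℝ) (x : R3) : ℝ :=
  fderiv ℝ φ x (EuclideanSpace.single i 1)

/-- `w` is the weak `i`-th partial derivative of `v`: for all real test functions
`φ ∈ C_c^∞(ℝ³)` one has `∫ (∂_i φ) v = - ∫ φ w`. -/
def HasWeakPartial (i : Fin 3) (v w : L2H) : Prop :=
  ∀ φ : R3 → ℝ, ContDiff ℝ ∞ φ → HasCompactSupport φ →
    ∫ x, partialDeriv i φ x • v x = -∫ x, φ x • w x

theorem integrable_smul_L2H {φ : R3 → ℝ} (hφ : Continuous φ) (hc : HasCompactSupport φ)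
    (v : L2H) : Integrable (fun x => φ x • v x) :=
  (((Lp.memLp v).locallyIntegrable (by norm_num)).integrable_smul_left_of_hasCompactSupport
    hφ hc)

theorem continuous_partialDeriv (i : Fin 3) {φ : R3 → ℝ} (hφ : ContDiff ℝ ∞ φ) :
    Continuous (partialDeriv i φ) :=
  (hφ.continuous_fderiv (by simp)).clm_apply continuous_const

theorem hasCompactSupport_partialDeriv (i : Fin 3) {φ : R3 → ℝ} (hc : HasCompactSupport φ) :
    HasCompactSupport (partialDeriv i φ) :=
  hc.fderiv_apply ℝ _

theorem HasWeakPartial.unique {i : Fin 3} {v w w' : L2H} (h : HasWeakPartial i v w)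
    (h' : HasWeakPartial i v w') : w = w' := by
  apply Lp.ext
  refine ae_eq_of_integral_contDiff_smul_eq
    ((Lp.memLp w).locallyIntegrable (by norm_num))
    ((Lp.memLp w').locallyIntegrable (by norm_num)) ?_
  intro φ hφ hc
  have h1 := h φ hφ hc
  rw [h' φ hφ hc] at h1
  exact (neg_injective h1).symm

theorem HasWeakPartial.zero (i : Fin 3) : HasWeakPartial i 0 0 := by
  intro φ _ _
  have h1 : ∫ x, partialDeriv i φ x • (0 : L2H) x = 0 := by
    rw [← integral_zero R3 (Quaternion ℝ)]
    apply integral_congr_ae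
    filter_upwards [Lp.coeFn_zero (Quaternion ℝ) 2 (volume : Measure R3)] with x hx
    rw [hx, Pi.zero_apply, smul_zero]
  have h2 : ∫ x, φ x • (0 : L2H) x = 0 := by
    rw [← integral_zero R3 (Quaternion ℝ)]
    apply integral_congr_ae
    filter_upwards [Lp.coeFn_zero (Quaternion ℝ) 2 (volume : Measure R3)] with x hx
    rw [hx, Pi.zero_apply, smul_zero]
  rw [h1, h2, neg_zero]

theorem integral_smul_add_L2H {φ : R3 → ℝ} (hφ : Continuous φ) (hc : HasCompactSupport φ)
    (v w : L2H) :
    ∫ x, φ x • (v + w) x = (∫ x, φ x • v x) + ∫ x, φ x • w x := by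
  rw [← integral_add (integrable_smul_L2H hφ hc v) (integrable_smul_L2H hφ hc w)]
  apply integral_congr_ae
  filter_upwards [Lp.coeFn_add v w] with x hx
  rw [hx, Pi.add_apply, smul_add]

theorem integral_smul_op_smul_L2H {φ : R3 → ℝ} (hφ : Continuous φ) (hc : HasCompactSupport φ)
    (c : (Quaternion ℝ)ᵐᵒᵖ) (v : L2H) :
    ∫ x, φ x • (c • v) x = c • ∫ x, φ x • v x := by
  have h1 := integral_mul_const_of_integrable (c := c.unop) (integrable_smul_L2H hφ hc v)
  rw [show c • ∫ x, φ x • v x = (∫ x, φ x • v x) * c.unop from rfl, ← h1]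
  apply integral_congr_ae
  filter_upwards [Lp.coeFn_smul c v] with x hx
  rw [hx, smul_mul_assoc]
  rfl

theorem HasWeakPartial.add {i : Fin 3} {v v' w w' : L2H} (h : HasWeakPartial i v w)
    (h' : HasWeakPartial i v' w') : HasWeakPartial i (v + v') (w + w') := by
  intro φ hφ hc
  rw [integral_smul_add_L2H (continuous_partialDeriv i hφ) (hasCompactSupport_partialDeriv i hc),
    integral_smul_add_L2H hφ.continuous hc, h φ hφ hc, h' φ hφ hc, neg_add]

theorem HasWeakPartial.smul {i : Fin 3} {v w : L2H} (c : (Quaternion ℝ)ᵐᵒᵖ)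
    (h : HasWeakPartial i v w) : HasWeakPartial i (c • v) (c • w) := by
  intro φ hφ hc
  rw [integral_smul_op_smul_L2H (continuous_partialDeriv i hφ)
      (hasCompactSupport_partialDeriv i hc),
    integral_smul_op_smul_L2H hφ.continuous hc, h φ hφ hc, smul_neg]

/-- The partial derivative `∂_i` as an unbounded right linear operator on `L²(ℝ³, ℍ)`: its domain
consists of all `v` that have a weak `i`-th partial derivative in `L²(ℝ³, ℍ)`. -/
def weakPartial (i : Fin 3) : L2H →ₗ.[(Quaternion ℝ)ᵐᵒᵖ] L2H where
  domain :=
    { carrier := {v | ∃ w, HasWeakPartial i v w}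
      zero_mem' := ⟨0, HasWeakPartial.zero i⟩
      add_mem' := by
        rintro a b ⟨w, hw⟩ ⟨w', hw'⟩
        exact ⟨w + w', hw.add hw'⟩
      smul_mem' := by
        rintro c a ⟨w, hw⟩
        exact ⟨c • w, hw.smul c⟩ }
  toFun :=
    { toFun := fun v => v.2.choose
      map_add' := fun a b => (a + b).2.choose_spec.unique (a.2.choose_spec.add b.2.choose_spec)
      map_smul' := fun c a => (c • a).2.choose_spec.unique (a.2.choose_spec.smul c) }

/-- The imaginary units `e₁`, `e₂`, `e₃` of the quaternions. -/
def e₁ : Quaternion ℝ := ⟨0, 1, 0, 0⟩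

/-- See `e₁`. -/
def e₂ : Quaternion ℝ := ⟨0, 0, 1, 0⟩

/-- See `e₁`. -/
def e₃ : Quaternion ℝ := ⟨0, 0, 0, 1⟩

/-- The quaternionic nabla operator `∇ v = e₁ ∂₁ v + e₂ ∂₂ v + e₃ ∂₃ v` on `L²(ℝ³, ℍ)`, where the
imaginary units multiply from the left. Its domain is the intersection of the domains of
the `∂_i`, that is, the Sobolev space `H¹(ℝ³, ℍ)`. -/
def nabla : L2H →ₗ.[(Quaternion ℝ)ᵐᵒᵖ] L2H :=
  e₁ • weakPartial 0 + e₂ • weakPartial 1 + e₃ • weakPartial 2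

end QuaternionicNabla

end

/-!
The Fourier transform turns `∇` into multiplication by a symbol, and the theorem into a statement
about that symbol.

Right multiplication by `ℂ ⊂ ℍ` makes `ℍ` a complex inner product space on which left
multiplication by quaternions is complex linear. Hence the Fourier transform `𝓕` of
`L²(ℝ³, ℍ)`, taken with this complex structure, is unitary (Plancherel), commutes with left
multiplication by the units `e_j` (`fourier_quaternion_smul`) and turns the weak derivative `∂_j`
into multiplication by `2πi ξ_j` (`hasWeakPartial_iff_fourier`). So `∇` becomes
`P(ξ) q = 2π (ξ₁e₁ + ξ₂e₂ + ξ₃e₃) q e₁`. This symbol satisfies `|P(ξ) q| = 2π|ξ||q|` and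
`P(ξ)² = (2π|ξ|)²`. The first identity is the elliptic estimate that makes the domain of `∇`
exactly the natural domain of the multiplication operator (`mem_graph_nabla_iff_fourier`).
Consequently `Q_s(∇)` is, with its exact domain, multiplication by
`M_s(ξ) = (2π|ξ|)² + |s|² - 2 Re(s) P(ξ)` (`mem_graph_Q_nabla_iff_fourier`).

The triangle inequality gives `|M_s(ξ) q| ≥ ((2π|ξ| - |Re s|)² + |Im s|²) |q|`
(`le_norm_qSymbol`). If `s` is not real, `M_s(ξ)` is therefore bounded below uniformly in `ξ`, and
since `P(ξ)²` is a scalar it has the explicit inverse `qSymbolInv`; so `Q_s(∇)` has a bounded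
inverse. Right linearity of the inverse is automatic, as it inverts a right linear map.

If `s = r` is real, `M_r(ξ₀) 1 = 0` at `ξ₀ = (-r/2π, 0, 0)`. By continuity, the functions whose
Fourier transforms are indicators of small balls around `ξ₀` are approximate null vectors of
`Q_r(∇)` (`exists_approximate_kernel`), which rules out a bounded inverse.
-/

noncomputable section

namespace QuaternionicNabla

open MeasureTheory Filter Topology LineDeriv FourierTransform
open scoped ENNReal ContDiff SchwartzMap

/-! ### The complex structure on the quaternions by right multiplication -/

/-- The complex vector space structure on `ℍ` given by right multiplication, `z • q = q z`, where `ℂ`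
is embedded by `i ↦ e₁`. -/
instance rightComplexModule : Module ℂ (Quaternion ℝ) where
  smul z q := q * (z : Quaternion ℝ)
  one_smul q := by
    change q * ((1 : ℂ) : Quaternion ℝ) = q
    simp
  mul_smul z w q := by
    change q * ((z * w : ℂ) : Quaternion ℝ) = q * (w : Quaternion ℝ) * (z : Quaternion ℝ)
    rw [mul_comm z w, Quaternion.coeComplex_mul, mul_assoc]
  smul_zero z := zero_mul _
  smul_add z p q := add_mul _ _ _
  add_smul z w q := by
    change q * ((z + w : ℂ) : Quaternion ℝ) = q * (z : Quaternion ℝ) + q * (w : Quaternion ℝ)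
    rw [Quaternion.coeComplex_add, mul_add]
  zero_smul q := by
    change q * ((0 : ℂ) : Quaternion ℝ) = 0
    simp

theorem complex_smul_def (z : ℂ) (q : Quaternion ℝ) : z • q = q * (z : Quaternion ℝ) := rfl

theorem norm_coeComplex (z : ℂ) : ‖(z : Quaternion ℝ)‖ = ‖z‖ := by
  have h : ‖(z : Quaternion ℝ)‖ * ‖(z : Quaternion ℝ)‖ = ‖z‖ * ‖z‖ := by
    rw [← Quaternion.normSq_eq_norm_mul_self, Quaternion.normSq_def', ← pow_two ‖z‖,
      ← Complex.normSq_eq_norm_sq, Complex.normSq_apply]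
    simp
    ring
  exact (mul_self_inj (norm_nonneg _) (norm_nonneg _)).1 h

/-- The inner product is the component of `p̄ q` in `ℂ = ℝ + ℝ e₁`, conjugate linear in `p`. Its norm
is the usual norm of the quaternions. -/
instance rightComplexInnerProductSpace : InnerProductSpace ℂ (Quaternion ℝ) where
  norm_smul_le z q := by
    rw [complex_smul_def, norm_mul, norm_coeComplex, mul_comm]
  inner p q := ⟨(star p * q).re, (star p * q).imI⟩
  norm_sq_eq_re_inner q := by
    rw [pow_two, ← Quaternion.normSq_eq_norm_mul_self, Quaternion.normSq_def]
    simp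
  conj_inner_symm p q := by
    apply Complex.ext <;> simp <;> ring
  add_left p q r := by
    apply Complex.ext <;> simp [add_mul]
  smul_left p q z := by
    apply Complex.ext <;> simp [complex_smul_def] <;> ring

theorem complex_ofReal_smul (r : ℝ) (q : Quaternion ℝ) : (r : ℂ) • q = r • q := by
  rw [complex_smul_def, Quaternion.coeComplex_coe, Quaternion.mul_coe_eq_smul]

/-- The real structures on `ℍ` that come from the complex structure and from the quaternions are equal
but not definitionally so. Mathlib's results on `𝓢'(R3, ℍ)` use the former. -/
theorem complexToReal_eq :
    (NormedSpace.complexToReal : NormedSpace ℝ (Quaternion ℝ)) =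
      InnerProductSpace.toNormedSpace := by
  have h : ∀ (r : ℝ) (q : Quaternion ℝ),
      (NormedSpace.complexToReal : NormedSpace ℝ (Quaternion ℝ)).smul r q = r • q :=
    complex_ofReal_smul
  ext r q : 3
  exact h r q

theorem integral_complexToReal (f : R3 → Quaternion ℝ) :
    @integral R3 (Quaternion ℝ) _ NormedSpace.complexToReal _ volume f = ∫ x, f x := by
  rw [complexToReal_eq]

instance : SMulCommClass ℝ ℂ (Quaternion ℝ) where
  smul_comm r z q := by rw [complex_smul_def, complex_smul_def, smul_mul_assoc]

/-! ### Weak derivatives tested against smooth functions in `H¹` -/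

/-- A smooth bump function on `ℝ³` that is `1` on the unit ball and vanishes outside the ball of
radius `2`. -/
def cutoffBump : ContDiffBump (0 : R3) := ⟨1, 2, one_pos, one_lt_two⟩

/-- The bump function rescaled to length scale `n + 1`. It tends to `1` pointwise, with derivatives of
size `O(1 / n)`. -/
def cutoff (n : ℕ) (x : R3) : ℝ := cutoffBump (((n : ℝ) + 1)⁻¹ • x)

theorem contDiff_cutoff (n : ℕ) : ContDiff ℝ ∞ (cutoff n) :=
  cutoffBump.contDiff.comp (contDiff_id.const_smul _)

theorem hasCompactSupport_cutoff (n : ℕ) : HasCompactSupport (cutoff n) :=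
  cutoffBump.hasCompactSupport.comp_smul (inv_ne_zero (by positivity))

theorem abs_cutoff_le (n : ℕ) (x : R3) : |cutoff n x| ≤ 1 :=
  (abs_of_nonneg cutoffBump.nonneg).trans_le cutoffBump.le_one

theorem tendsto_inv_smul (x : R3) :
    Tendsto (fun n : ℕ => ((n : ℝ) + 1)⁻¹ • x) atTop (𝓝 0) := by
  have h := (tendsto_one_div_add_atTop_nhds_zero_nat (𝕜 := ℝ)).smul_const x
  simpa using h

theorem tendsto_cutoff (x : R3) : Tendsto (fun n => cutoff n x) atTop (𝓝 1) := by
  have h := (cutoffBump.continuous.tendsto 0).comp (tendsto_inv_smul x)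
  rwa [cutoffBump.one_of_mem_closedBall
    (Metric.mem_closedBall_self cutoffBump.rIn_pos.le)] at h

theorem partialDeriv_cutoff (i : Fin 3) (n : ℕ) (x : R3) :
    partialDeriv i (cutoff n) x =
      ((n : ℝ) + 1)⁻¹ * partialDeriv i cutoffBump (((n : ℝ) + 1)⁻¹ • x) := by
  unfold partialDeriv cutoff
  rw [fderiv_comp_smul]
  simp

theorem exists_abs_partialDeriv_cutoff_le (i : Fin 3) :
    ∃ K : ℝ, 0 ≤ K ∧ ∀ n x, |partialDeriv i (cutoff n) x| ≤ ((n : ℝ) + 1)⁻¹ * K := by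
  obtain ⟨K, hK⟩ := (hasCompactSupport_partialDeriv i
    cutoffBump.hasCompactSupport).exists_bound_of_continuous
    (continuous_partialDeriv i cutoffBump.contDiff)
  refine ⟨K, (norm_nonneg _).trans (hK 0), fun n x => ?_⟩
  rw [partialDeriv_cutoff, abs_mul, abs_of_nonneg (by positivity : (0 : ℝ) ≤ ((n : ℝ) + 1)⁻¹)]
  gcongr
  exact hK _

theorem partialDeriv_mul (i : Fin 3) {f g : R3 → ℝ} (hf : ContDiff ℝ ∞ f) (hg : ContDiff ℝ ∞ g)
    (x : R3) : partialDeriv i (fun y => f y * g y) x =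
      f x * partialDeriv i g x + partialDeriv i f x * g x := by
  unfold partialDeriv
  have h := fderiv_mul (hf.differentiable (by simp) x) (hg.differentiable (by simp) x)
  change (fderiv ℝ (f * g) x) _ = _
  rw [h]
  simp [mul_comm]

theorem integrable_smul_of_memLp {f : R3 → ℝ} (hf : MemLp f 2 volume) (v : L2H) :
    Integrable (fun x => f x • v x) :=
  memLp_one_iff_integrable.1 ((Lp.memLp v).smul hf)

/-- The defining identity of the weak derivative extends by cutting off from test functions to all
smooth `f` with `f` and `∂_i f` in `L²`, in particular to Schwartz functions. -/
theorem HasWeakPartial.integral_eq_of_memLp {i : Fin 3} {v w : L2H} (h : HasWeakPartial i v w)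
    {f : R3 → ℝ} (hf : ContDiff ℝ ∞ f) (hf2 : MemLp f 2 volume)
    (hf2' : MemLp (partialDeriv i f) 2 volume) :
    ∫ x, partialDeriv i f x • v x = -∫ x, f x • w x := by
  obtain ⟨K, hK0, hK⟩ := exists_abs_partialDeriv_cutoff_le i
  have hv := (integrable_smul_of_memLp hf2 v).norm
  have hv' := (integrable_smul_of_memLp hf2' v).norm
  have hw := (integrable_smul_of_memLp hf2 w).norm
  have hlim1 : Tendsto (fun n => ∫ x, partialDeriv i (fun y => cutoff n y * f y) x • v x) atTop
      (𝓝 (∫ x, partialDeriv i f x • v x)) := by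
    refine tendsto_integral_of_dominated_convergence
      (fun x => ‖partialDeriv i f x • v x‖ + K * ‖f x • v x‖) (fun n => ?_)
      (hv'.add (hv.const_mul K)) (fun n => ?_) ?_
    · exact (integrable_smul_L2H (continuous_partialDeriv i ((contDiff_cutoff n).mul hf))
        (hasCompactSupport_partialDeriv i (hasCompactSupport_cutoff n).mul_right)
        v).aestronglyMeasurable
    · refine Eventually.of_forall fun x => ?_
      rw [partialDeriv_mul i (contDiff_cutoff n) hf, add_smul, mul_smul, mul_smul]
      refine (norm_add_le _ _).trans (add_le_add ?_ ?_)
      · rw [norm_smul (cutoff n x)]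
        exact mul_le_of_le_one_left (norm_nonneg _) (abs_cutoff_le n x)
      · rw [norm_smul (partialDeriv i _ x)]
        refine mul_le_mul_of_nonneg_right ((hK n x).trans ?_) (norm_nonneg _)
        refine mul_le_of_le_one_left hK0 (inv_le_one_of_one_le₀ ?_)
        linarith [(Nat.cast_nonneg n : (0 : ℝ) ≤ n)]
    · refine Eventually.of_forall fun x => Tendsto.smul_const ?_ _
      simp only [partialDeriv_mul i (contDiff_cutoff _) hf]
      have h0 : Tendsto (fun n => partialDeriv i (cutoff n) x) atTop (𝓝 0) := by
        refine squeeze_zero_norm (hK · x) ?_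
        have h := (tendsto_one_div_add_atTop_nhds_zero_nat (𝕜 := ℝ)).mul_const K
        simpa using h
      simpa using ((tendsto_cutoff x).mul_const _).add (h0.mul_const (f x))
  have hlim2 : Tendsto (fun n => ∫ x, (cutoff n x * f x) • w x) atTop
      (𝓝 (∫ x, f x • w x)) := by
    refine tendsto_integral_of_dominated_convergence (fun x => ‖f x • w x‖) (fun n => ?_)
      hw (fun n => ?_) ?_
    · exact (integrable_smul_L2H ((contDiff_cutoff n).mul hf).continuous
        (hasCompactSupport_cutoff n).mul_right w).aestronglyMeasurable
    · refine Eventually.of_forall fun x => ?_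
      rw [mul_smul, norm_smul (cutoff n x)]
      exact mul_le_of_le_one_left (norm_nonneg _) (abs_cutoff_le n x)
    · refine Eventually.of_forall fun x => Tendsto.smul_const ?_ _
      simpa using (tendsto_cutoff x).mul_const (f x)
  refine tendsto_nhds_unique hlim1 (hlim2.neg.congr fun n => ?_)
  exact (h _ ((contDiff_cutoff n).mul hf) (hasCompactSupport_cutoff n).mul_right).symm

/-! ### Weak derivatives under the Fourier transform -/

theorem toTemperedDistribution_eq_integral (v : L2H) (g : 𝓢(R3, ℂ)) :
    Lp.toTemperedDistribution v g = ∫ x, g x • v x := by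
  rw [Lp.toTemperedDistribution_apply, integral_complexToReal]

theorem toTemperedDistribution_injective :
    Function.Injective (fun v : L2H => (Lp.toTemperedDistribution v : 𝓢'(R3, Quaternion ℝ))) := by
  intro v w h
  have hk := Lp.ker_toTemperedDistributionCLM_eq_bot (F := Quaternion ℝ) (E := R3) (p := 2)
    (μ := volume)
  exact LinearMap.ker_eq_bot.1 hk h

/-- A real test function as a complex-valued Schwartz function. -/
def testToSchwartz {φ : R3 → ℝ} (hφ : ContDiff ℝ ∞ φ) (hc : HasCompactSupport φ) : 𝓢(R3, ℂ) :=
  HasCompactSupport.toSchwartzMap (f := fun x => (φ x : ℂ)) (hc.comp_left Complex.ofReal_zero)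
    (Complex.ofRealCLM.contDiff.comp hφ)

theorem testToSchwartz_apply {φ : R3 → ℝ} (hφ : ContDiff ℝ ∞ φ) (hc : HasCompactSupport φ)
    (x : R3) : testToSchwartz hφ hc x = φ x := rfl

theorem lineDerivOp_testToSchwartz {φ : R3 → ℝ} (hφ : ContDiff ℝ ∞ φ) (hc : HasCompactSupport φ)
    (i : Fin 3) (x : R3) :
    (∂_{EuclideanSpace.single i (1 : ℝ)} (testToSchwartz hφ hc)) x = (partialDeriv i φ x : ℂ) := by
  rw [SchwartzMap.lineDerivOp_apply_eq_fderiv]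
  have h := (Complex.ofRealCLM.hasFDerivAt.comp x
    ((hφ.differentiable (by simp) x).hasFDerivAt)).fderiv
  exact congrArg (fun T : R3 →L[ℝ] ℂ => T (EuclideanSpace.single i (1 : ℝ))) h

theorem HasWeakPartial.of_lineDerivOp_eq {i : Fin 3} {v w : L2H}
    (h : ∂_{EuclideanSpace.single i (1 : ℝ)} (Lp.toTemperedDistribution v) =
      Lp.toTemperedDistribution w) : HasWeakPartial i v w := by
  intro φ hφ hc
  have h1 := DFunLike.congr_fun h (testToSchwartz hφ hc)
  rw [TemperedDistribution.lineDerivOp_apply_apply, map_neg, toTemperedDistribution_eq_integral,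
    toTemperedDistribution_eq_integral] at h1
  simp only [lineDerivOp_testToSchwartz, testToSchwartz_apply, complex_ofReal_smul] at h1
  rw [← h1, neg_neg]

theorem integrable_schwartz_smul (g : 𝓢(R3, ℂ)) (v : L2H) : Integrable (fun x => g x • v x) :=
  memLp_one_iff_integrable.1 ((Lp.memLp v).smul (g.memLp 2 volume))

theorem complex_smul_eq (z : ℂ) (q : Quaternion ℝ) : z • q = z.re • q + z.im • (Complex.I • q) := by
  rw [← complex_ofReal_smul, ← complex_ofReal_smul, smul_smul, ← add_smul, Complex.re_add_im]

theorem HasWeakPartial.lineDerivOp_eq {i : Fin 3} {v w : L2H} (h : HasWeakPartial i v w) :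
    ∂_{EuclideanSpace.single i (1 : ℝ)} (Lp.toTemperedDistribution v) =
      Lp.toTemperedDistribution w := by
  ext1 g
  rw [TemperedDistribution.lineDerivOp_apply_apply, map_neg, toTemperedDistribution_eq_integral,
    toTemperedDistribution_eq_integral, neg_eq_iff_eq_neg]
  -- Both sides are split along the real and imaginary part of the test function.
  have key : ∀ T : ℂ →L[ℝ] ℝ,
      ∫ x, T ((∂_{EuclideanSpace.single i (1 : ℝ)} g) x) • v x = -∫ x, T (g x) • w x := by
    intro T
    have hd : ∀ x, partialDeriv i (fun y => T (g y)) x =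
        T ((∂_{EuclideanSpace.single i (1 : ℝ)} g) x) := by
      intro x
      rw [SchwartzMap.lineDerivOp_apply_eq_fderiv]
      have h := (T.hasFDerivAt.comp x (g.differentiableAt (x := x)).hasFDerivAt).fderiv
      exact congrArg (fun T : R3 →L[ℝ] ℝ => T (EuclideanSpace.single i (1 : ℝ))) h
    have h0 := h.integral_eq_of_memLp (f := fun y => T (g y)) (T.contDiff.comp g.smooth')
      (T.comp_memLp' (g.memLp 2 volume)) (by
        rw [funext hd]
        exact T.comp_memLp' ((∂_{EuclideanSpace.single i (1 : ℝ)} g).memLp 2 volume))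
    simpa only [hd] using h0
  have split : ∀ (g : 𝓢(R3, ℂ)) (v : L2H), ∫ x, g x • v x =
      (∫ x, Complex.reCLM (g x) • v x) + Complex.I • ∫ x, Complex.imCLM (g x) • v x := by
    intro g v
    have hre : Integrable (fun x => Complex.reCLM (g x) • v x) :=
      integrable_smul_of_memLp (Complex.reCLM.comp_memLp' (g.memLp 2 volume)) v
    have him : Integrable (fun x => Complex.imCLM (g x) • v x) :=
      integrable_smul_of_memLp (Complex.imCLM.comp_memLp' (g.memLp 2 volume)) v
    rw [← integral_smul]
    refine Eq.trans ?_ (integral_add hre (him.smul Complex.I))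
    refine integral_congr_ae (Eventually.of_forall fun x => ?_)
    change g x • v x = (g x).re • v x + Complex.I • ((g x).im • v x)
    rw [complex_smul_eq, smul_comm]
  rw [split, split, key, key, smul_neg, neg_add]

/-- The equation `∂_i v = w` between tempered distributions, on the Fourier side. -/
theorem lineDerivOp_eq_iff (i : Fin 3) (v w : L2H) :
    ∂_{EuclideanSpace.single i (1 : ℝ)} (Lp.toTemperedDistribution v) =
      Lp.toTemperedDistribution w ↔
    ∀ᵐ ξ, (𝓕 w : L2H) ξ = (2 * Real.pi * Complex.I * (ξ i : ℂ)) • (𝓕 v : L2H) ξ := by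
  have hinj : Function.Injective (𝓕 : 𝓢'(R3, Quaternion ℝ) → 𝓢'(R3, Quaternion ℝ)) :=
    Function.LeftInverse.injective (g := (𝓕⁻ : 𝓢'(R3, Quaternion ℝ) → 𝓢'(R3, Quaternion ℝ)))
      fun a => fourierInv_fourier_eq a
  have hinner : ∀ x : R3, inner ℝ x (EuclideanSpace.single i (1 : ℝ)) = x i := by
    intro x
    simp [EuclideanSpace.inner_single_right]
  have hgrowth : (fun x : R3 =>
      ((inner ℝ x (EuclideanSpace.single i (1 : ℝ)) : ℝ) : ℂ)).HasTemperateGrowth := by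
    fun_prop
  rw [← hinj.eq_iff, TemperedDistribution.fourier_lineDerivOp_eq,
    Lp.fourier_toTemperedDistribution_eq, Lp.fourier_toTemperedDistribution_eq]
  have happly : ∀ g : 𝓢(R3, ℂ), ((2 * Real.pi * Complex.I) • TemperedDistribution.smulLeftCLM _
      (fun x : R3 => ((inner ℝ x (EuclideanSpace.single i (1 : ℝ)) : ℝ) : ℂ))
      (Lp.toTemperedDistribution (𝓕 v : L2H))) g =
      ∫ ξ, g ξ • (2 * Real.pi * Complex.I * (ξ i : ℂ)) • (𝓕 v : L2H) ξ := by
    intro g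
    change (2 * Real.pi * Complex.I : ℂ) • (Lp.toTemperedDistribution (𝓕 v : L2H))
      (SchwartzMap.smulLeftCLM ℂ _ g) = _
    rw [toTemperedDistribution_eq_integral, ← integral_smul]
    refine integral_congr_ae (Eventually.of_forall fun ξ => ?_)
    dsimp only
    rw [SchwartzMap.smulLeftCLM_apply_apply hgrowth, hinner, smul_smul, smul_smul, smul_eq_mul]
    congr 1
    ring
  constructor
  · intro h
    refine ae_eq_of_integral_contDiff_smul_eq
      ((Lp.memLp (𝓕 w : L2H)).locallyIntegrable (by norm_num)) ?_ ?_
    · rw [← locallyIntegrableOn_univ]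
      refine LocallyIntegrableOn.continuousOn_smul isOpen_univ.isLocallyClosed
        (((Lp.memLp (𝓕 v : L2H)).locallyIntegrable (by norm_num)).locallyIntegrableOn _)
        (Continuous.continuousOn ?_)
      fun_prop
    · intro φ hφ hc
      have h1 := DFunLike.congr_fun h (testToSchwartz hφ hc)
      rw [happly, toTemperedDistribution_eq_integral] at h1
      simpa only [testToSchwartz_apply, complex_ofReal_smul] using h1.symm
  · intro h
    ext1 g
    rw [happly, toTemperedDistribution_eq_integral]
    refine integral_congr_ae ?_
    filter_upwards [h] with ξ hξ
    rw [hξ]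

/-- `v` has the weak derivative `∂_i v = w` in `L²` exactly if `ŵ = 2πi ξ_i v̂`. -/
theorem hasWeakPartial_iff_fourier (i : Fin 3) (v w : L2H) :
    HasWeakPartial i v w ↔
    ∀ᵐ ξ, (𝓕 w : L2H) ξ = (2 * Real.pi * Complex.I * (ξ i : ℂ)) • (𝓕 v : L2H) ξ := by
  rw [← lineDerivOp_eq_iff]
  exact ⟨HasWeakPartial.lineDerivOp_eq, HasWeakPartial.of_lineDerivOp_eq⟩

/-! ### The symbols of `∇` and `Q_s(∇)` -/

@[simp] theorem re_e₁ : e₁.re = 0 := rfl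
@[simp] theorem imI_e₁ : e₁.imI = 1 := rfl
@[simp] theorem imJ_e₁ : e₁.imJ = 0 := rfl
@[simp] theorem imK_e₁ : e₁.imK = 0 := rfl
@[simp] theorem re_e₂ : e₂.re = 0 := rfl
@[simp] theorem imI_e₂ : e₂.imI = 0 := rfl
@[simp] theorem imJ_e₂ : e₂.imJ = 1 := rfl
@[simp] theorem imK_e₂ : e₂.imK = 0 := rfl
@[simp] theorem re_e₃ : e₃.re = 0 := rfl
@[simp] theorem imI_e₃ : e₃.imI = 0 := rfl
@[simp] theorem imJ_e₃ : e₃.imJ = 0 := rfl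
@[simp] theorem imK_e₃ : e₃.imK = 1 := rfl

/-- The imaginary quaternion `ξ₁e₁ + ξ₂e₂ + ξ₃e₃` with the coordinates of `ξ`. -/
def vec (ξ : R3) : Quaternion ℝ := ξ 0 • e₁ + ξ 1 • e₂ + ξ 2 • e₃

/-- The Fourier symbol of `∇`. The factor `i` of `2πi ξ_j` acts as right multiplication by `e₁`. -/
def nablaSymbol (ξ : R3) (q : Quaternion ℝ) : Quaternion ℝ := (2 * Real.pi) • (vec ξ * q * e₁)

/-- The Fourier symbol of `Q_s(∇)`, with the square of the symbol of `∇` replaced by its value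
`(2π|ξ|)²`, see `nablaSymbol_nablaSymbol`. -/
def qSymbol (s : Quaternion ℝ) (ξ : R3) (q : Quaternion ℝ) : Quaternion ℝ :=
  ((2 * Real.pi * ‖ξ‖) ^ 2 + ‖s‖ ^ 2) • q - (2 * s.re) • nablaSymbol ξ q

theorem norm_sq_R3 (ξ : R3) : ‖ξ‖ ^ 2 = ξ 0 ^ 2 + ξ 1 ^ 2 + ξ 2 ^ 2 := by
  rw [EuclideanSpace.norm_sq_eq, Fin.sum_univ_three]
  simp

theorem norm_sq_quaternion (q : Quaternion ℝ) :
    ‖q‖ ^ 2 = q.re ^ 2 + q.imI ^ 2 + q.imJ ^ 2 + q.imK ^ 2 := by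
  rw [pow_two, ← Quaternion.normSq_eq_norm_mul_self, Quaternion.normSq_def']

theorem norm_vec (ξ : R3) : ‖vec ξ‖ = ‖ξ‖ := by
  rw [← sq_eq_sq₀ (norm_nonneg _) (norm_nonneg _), norm_sq_R3, norm_sq_quaternion]
  simp [vec]

theorem norm_e₁ : ‖e₁‖ = 1 := by
  rw [← sq_eq_sq₀ (norm_nonneg _) zero_le_one, norm_sq_quaternion]
  simp

theorem continuous_nablaSymbol : Continuous fun p : R3 × Quaternion ℝ => nablaSymbol p.1 p.2 := by
  unfold nablaSymbol vec
  fun_prop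

theorem norm_nablaSymbol (ξ : R3) (q : Quaternion ℝ) :
    ‖nablaSymbol ξ q‖ = 2 * Real.pi * ‖ξ‖ * ‖q‖ := by
  rw [nablaSymbol, norm_smul, norm_mul (vec ξ * q), norm_mul (vec ξ), norm_vec,
    norm_e₁, Real.norm_of_nonneg Real.two_pi_pos.le]
  ring

theorem nablaSymbol_nablaSymbol (ξ : R3) (q : Quaternion ℝ) :
    nablaSymbol ξ (nablaSymbol ξ q) = (2 * Real.pi * ‖ξ‖) ^ 2 • q := by
  rw [mul_pow _ ‖ξ‖, norm_sq_R3]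
  ext <;> simp [nablaSymbol, vec] <;> ring

theorem nablaSymbol_add (ξ : R3) (p q : Quaternion ℝ) :
    nablaSymbol ξ (p + q) = nablaSymbol ξ p + nablaSymbol ξ q := by
  simp only [nablaSymbol, mul_add, add_mul, smul_add]

theorem nablaSymbol_smul (ξ : R3) (r : ℝ) (q : Quaternion ℝ) :
    nablaSymbol ξ (r • q) = r • nablaSymbol ξ q := by
  simp only [nablaSymbol, mul_smul_comm, smul_mul_assoc, smul_comm r]

theorem partial_smul (t : ℝ) (q : Quaternion ℝ) :
    (2 * Real.pi * Complex.I * (t : ℂ)) • q = (2 * Real.pi * t) • (q * e₁) := by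
  have h : (2 * Real.pi * Complex.I * (t : ℂ)) = ((2 * Real.pi * t : ℝ) : ℂ) * Complex.I := by
    push_cast
    ring
  rw [h, mul_smul, complex_ofReal_smul]
  rfl

theorem sum_unit_mul_partial (ξ : R3) (q : Quaternion ℝ) :
    e₁ * ((2 * Real.pi * Complex.I * (ξ 0 : ℂ)) • q) +
      e₂ * ((2 * Real.pi * Complex.I * (ξ 1 : ℂ)) • q) +
      e₃ * ((2 * Real.pi * Complex.I * (ξ 2 : ℂ)) • q) = nablaSymbol ξ q := by
  simp only [partial_smul, nablaSymbol, vec]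
  ext <;> simp <;> ring

theorem norm_partial_le (i : Fin 3) (ξ : R3) (q : Quaternion ℝ) :
    ‖(2 * Real.pi * Complex.I * (ξ i : ℂ)) • q‖ ≤ ‖nablaSymbol ξ q‖ := by
  rw [norm_nablaSymbol, norm_smul]
  gcongr
  simp only [norm_mul, Complex.norm_I, Complex.norm_real, mul_one, Complex.norm_ofNat,
    Real.norm_of_nonneg Real.pi_pos.le]
  gcongr
  exact PiLp.norm_apply_le ξ i

/-! ### The graph of `∇` on the Fourier side -/

/-- The Fourier transform commutes with left multiplication by a quaternion, since that is linear for
the complex structure by right multiplication. -/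
theorem fourier_quaternion_smul (a : Quaternion ℝ) (v : L2H) :
    (𝓕 (a • v) : L2H) = a • (𝓕 v : L2H) := by
  have hsmul : ∀ (v : L2H) (g : SchwartzMap R3 ℂ),
      Lp.toTemperedDistribution (a • v) g = a * Lp.toTemperedDistribution v g := by
    intro v g
    rw [toTemperedDistribution_eq_integral, toTemperedDistribution_eq_integral,
      ← integral_const_mul_of_integrable (integrable_schwartz_smul g v)]
    refine integral_congr_ae ?_
    filter_upwards [Lp.coeFn_smul a v] with x hx
    rw [hx, Pi.smul_apply, smul_eq_mul, complex_smul_def, complex_smul_def, mul_assoc]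
  apply toTemperedDistribution_injective
  ext1 g
  dsimp only
  rw [← Lp.fourier_toTemperedDistribution_eq, TemperedDistribution.fourier_apply, hsmul, hsmul,
    ← Lp.fourier_toTemperedDistribution_eq, TemperedDistribution.fourier_apply]

theorem real_smul_L2H (r : ℝ) (v : L2H) : r • v = (r : Quaternion ℝ) • v := by
  apply Lp.ext
  filter_upwards [Lp.coeFn_smul r v, Lp.coeFn_smul (r : Quaternion ℝ) v] with x h h'
  rw [h, h', Pi.smul_apply, Pi.smul_apply, smul_eq_mul, Quaternion.coe_mul_eq_smul]

theorem fourier_real_smul (r : ℝ) (v : L2H) : (𝓕 (r • v) : L2H) = r • (𝓕 v : L2H) := by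
  rw [real_smul_L2H, fourier_quaternion_smul, real_smul_L2H]

theorem fourier_injective : Function.Injective (𝓕 : L2H → L2H) :=
  (Lp.fourierTransformₗᵢ R3 (Quaternion ℝ)).injective

theorem fourier_surjective : Function.Surjective (𝓕 : L2H → L2H) :=
  (Lp.fourierTransformₗᵢ R3 (Quaternion ℝ)).surjective

theorem exists_fourier_ae_eq {g : R3 → Quaternion ℝ} (hg : MemLp g 2 volume) :
    ∃ w : L2H, ∀ᵐ ξ, (𝓕 w : L2H) ξ = g ξ := by
  obtain ⟨w, hw⟩ := fourier_surjective (hg.toLp g)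
  exact ⟨w, hw ▸ hg.coeFn_toLp⟩

theorem mem_graph_nabla_iff (u f : L2H) :
    (u, f) ∈ nabla.graph ↔ ∃ w : Fin 3 → L2H, (∀ i, HasWeakPartial i u (w i)) ∧
      f = e₁ • w 0 + e₂ • w 1 + e₃ • w 2 := by
  rw [LinearPMap.mem_graph_iff]
  constructor
  · rintro ⟨⟨v, h⟩, rfl, rfl⟩
    obtain ⟨⟨h0, h1⟩, h2⟩ := h
    refine ⟨![weakPartial 0 ⟨v, h0⟩, weakPartial 1 ⟨v, h1⟩, weakPartial 2 ⟨v, h2⟩], ?_, rfl⟩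
    intro i
    fin_cases i
    · exact h0.choose_spec
    · exact h1.choose_spec
    · exact h2.choose_spec
  · rintro ⟨w, hw, rfl⟩
    have hi : ∀ i, ∃ h : u ∈ (weakPartial i).domain, weakPartial i ⟨u, h⟩ = w i := fun i =>
      ⟨⟨w i, hw i⟩, (Exists.choose_spec (⟨w i, hw i⟩ : ∃ w, HasWeakPartial i u w)).unique (hw i)⟩
    choose h hh using hi
    refine ⟨⟨u, ⟨h 0, h 1⟩, h 2⟩, rfl, ?_⟩
    rw [← hh 0, ← hh 1, ← hh 2]
    rfl

theorem coeFn_sum_unit_smul (w : Fin 3 → L2H) :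
    ∀ᵐ x, (e₁ • w 0 + e₂ • w 1 + e₃ • w 2 : L2H) x =
      e₁ * w 0 x + e₂ * w 1 x + e₃ * w 2 x := by
  filter_upwards [Lp.coeFn_add (e₁ • w 0 + e₂ • w 1) (e₃ • w 2),
    Lp.coeFn_add (e₁ • w 0) (e₂ • w 1), Lp.coeFn_smul e₁ (w 0), Lp.coeFn_smul e₂ (w 1),
    Lp.coeFn_smul e₃ (w 2)] with x h1 h2 h3 h4 h5
  rw [h1, Pi.add_apply, h2, Pi.add_apply, h3, h4, h5]
  rfl

theorem fourier_add_L2H (v w : L2H) : (𝓕 (v + w) : L2H) = 𝓕 v + 𝓕 w :=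
  (Lp.fourierTransformₗᵢ R3 (Quaternion ℝ)).map_add v w

/-- The operator `∇` with domain `H¹` is unitarily equivalent to multiplication by `nablaSymbol` with
its maximal domain. -/
theorem mem_graph_nabla_iff_fourier (u f : L2H) :
    (u, f) ∈ nabla.graph ↔ ∀ᵐ ξ, (𝓕 f : L2H) ξ = nablaSymbol ξ ((𝓕 u : L2H) ξ) := by
  have hsum : ∀ w : Fin 3 → L2H, (∀ i, HasWeakPartial i u (w i)) →
      ∀ᵐ ξ, (𝓕 (e₁ • w 0 + e₂ • w 1 + e₃ • w 2) : L2H) ξ = nablaSymbol ξ ((𝓕 u : L2H) ξ) := by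
    intro w hw
    simp only [hasWeakPartial_iff_fourier] at hw
    rw [fourier_add_L2H, fourier_add_L2H, fourier_quaternion_smul, fourier_quaternion_smul,
      fourier_quaternion_smul]
    filter_upwards [coeFn_sum_unit_smul fun i => 𝓕 (w i), hw 0, hw 1, hw 2] with ξ h h0 h1 h2
    rw [h, h0, h1, h2, sum_unit_mul_partial]
  rw [mem_graph_nabla_iff]
  constructor
  · rintro ⟨w, hw, rfl⟩
    exact hsum w hw
  · intro h
    -- Each `ξ_i û` is dominated by the symbol of `∇` applied to `û`, hence is in `L²`.
    have hmem : ∀ i : Fin 3, MemLp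
        (fun ξ : R3 => (2 * Real.pi * Complex.I * (ξ i : ℂ)) • (𝓕 u : L2H) ξ) 2 volume := by
      intro i
      refine (Lp.memLp (𝓕 f : L2H)).of_le ?_ ?_
      · have hc : Continuous fun ξ : R3 => 2 * Real.pi * Complex.I * (ξ i : ℂ) := by fun_prop
        exact hc.aestronglyMeasurable.smul (Lp.memLp (𝓕 u : L2H)).aestronglyMeasurable
      · filter_upwards [h] with ξ hξ
        rw [hξ]
        exact norm_partial_le i ξ _
    choose w hw using fun i => exists_fourier_ae_eq (hmem i)
    have hw' : ∀ i, HasWeakPartial i u (w i) := fun i =>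
      (hasWeakPartial_iff_fourier i u (w i)).2 (hw i)
    refine ⟨w, hw', fourier_injective (Lp.ext ?_)⟩
    filter_upwards [h, hsum w hw'] with ξ h1 h2
    rw [h1, h2]

/-! ### Bounded inverses in terms of graphs -/

section Abstract

variable {V : Type*} [NormedAddCommGroup V] [Module (Quaternion ℝ)ᵐᵒᵖ V]

theorem mem_graph_Q_iff [NormedSpace ℝ V] [SMulCommClass (Quaternion ℝ)ᵐᵒᵖ ℝ V]
    (s : Quaternion ℝ) (T : V →ₗ.[(Quaternion ℝ)ᵐᵒᵖ] V) (u f : V) :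
    (u, f) ∈ (Q s T).graph ↔ ∃ w z, (u, w) ∈ T.graph ∧ (w, z) ∈ T.graph ∧
      f = z - (2 * s.re) • w + ‖s‖ ^ 2 • u := by
  simp only [LinearPMap.mem_graph_iff]
  constructor
  · rintro ⟨⟨v, h⟩, rfl, rfl⟩
    obtain ⟨⟨h1, h2⟩, -⟩ := h
    exact ⟨_, _, ⟨⟨v, h1.choose⟩, rfl, rfl⟩, ⟨⟨_, h1.choose_spec⟩, rfl, rfl⟩, rfl⟩
  · rintro ⟨w, z, ⟨⟨v, hv⟩, rfl, rfl⟩, ⟨⟨w, hw⟩, hvw, rfl⟩, rfl⟩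
    obtain rfl : w = T ⟨v, hv⟩ := hvw
    exact ⟨⟨v, ⟨⟨hv, hw⟩, hv⟩, trivial⟩, rfl, rfl⟩

/-- A right linear operator that is onto and bounded below has a bounded right linear inverse. -/
theorem hasBoundedInverse_of_graph {A : V →ₗ.[(Quaternion ℝ)ᵐᵒᵖ] V} (C : ℝ)
    (hsurj : ∀ f, ∃ u, (u, f) ∈ A.graph) (hC : ∀ u f, (u, f) ∈ A.graph → ‖u‖ ≤ C * ‖f‖) :
    HasBoundedInverse A := by
  have hbij : Function.Bijective A.toFun := by
    constructor
    · rw [injective_iff_map_eq_zero]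
      intro u hu
      have h := hC u 0 ((LinearPMap.mem_graph_iff A).2 ⟨u, rfl, hu⟩)
      rw [norm_zero, mul_zero, norm_le_zero_iff] at h
      exact Subtype.ext h
    · intro f
      obtain ⟨u, hu⟩ := hsurj f
      obtain ⟨v, -, hv⟩ := (LinearPMap.mem_graph_iff A).1 hu
      exact ⟨v, hv⟩
  let E := LinearEquiv.ofBijective A.toFun hbij
  have hE : ∀ f, A (E.symm f) = f := E.apply_symm_apply
  let B : V →ₗ[(Quaternion ℝ)ᵐᵒᵖ] V := A.domain.subtype ∘ₗ E.symm.toLinearMap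
  have hB : ∀ f, ‖B f‖ ≤ C * ‖f‖ := fun f =>
    hC _ f ((LinearPMap.mem_graph_iff A).2 ⟨E.symm f, rfl, hE f⟩)
  refine ⟨⟨B, AddMonoidHomClass.continuous_of_bound B C hB⟩, fun f => ?_, fun u => ?_⟩
  · exact ⟨(E.symm f).2, hE f⟩
  · exact congrArg Subtype.val (E.symm_apply_apply u)

theorem HasBoundedInverse.exists_bound [NormedSpace ℝ V] {A : V →ₗ.[(Quaternion ℝ)ᵐᵒᵖ] V}
    (h : HasBoundedInverse A) :
    ∃ C, 0 ≤ C ∧ ∀ u f, (u, f) ∈ A.graph → ‖u‖ ≤ C * ‖f‖ := by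
  obtain ⟨B, -, hB⟩ := h
  let B' : V →L[ℝ] V := B.toLinearMap.toAddMonoidHom.toRealLinearMap B.continuous
  refine ⟨‖B'‖, norm_nonneg _, fun u f huf => ?_⟩
  obtain ⟨v, rfl, rfl⟩ := (LinearPMap.mem_graph_iff A).1 huf
  have h1 := B'.le_opNorm (A v)
  rwa [show B' (A v) = v from hB v] at h1

end Abstract

/-! ### The graph of `Q_s(∇)` on the Fourier side -/

/-- The lower bound is `(2π|ξ| - |Re s|)² + |Im s|²`. -/
theorem le_norm_qSymbol (s : Quaternion ℝ) (ξ : R3) (q : Quaternion ℝ) :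
    ((2 * Real.pi * ‖ξ‖ - |s.re|) ^ 2 + (‖s‖ ^ 2 - s.re ^ 2)) * ‖q‖ ≤ ‖qSymbol s ξ q‖ := by
  have h := norm_sub_norm_le (((2 * Real.pi * ‖ξ‖) ^ 2 + ‖s‖ ^ 2) • q)
    ((2 * s.re) • nablaSymbol ξ q)
  rw [norm_smul, norm_smul, norm_nablaSymbol, Real.norm_of_nonneg (by positivity), norm_mul,
    Real.norm_two, Real.norm_eq_abs] at h
  refine le_trans (le_of_eq ?_) h
  rw [← sq_abs s.re]
  ring

theorem re_sq_le_norm_sq (s : Quaternion ℝ) : s.re ^ 2 ≤ ‖s‖ ^ 2 := by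
  rw [norm_sq_quaternion]
  nlinarith [sq_nonneg s.imI, sq_nonneg s.imJ, sq_nonneg s.imK]

/-- If `u` and `Q_s(∇) u` are in `L²` on the Fourier side, then so is `∇ u`. -/
theorem norm_nablaSymbol_le (s : Quaternion ℝ) (ξ : R3) (q : Quaternion ℝ) :
    ‖nablaSymbol ξ q‖ ≤ ‖qSymbol s ξ q‖ + (2 * |s.re| + 1) ^ 2 * ‖q‖ := by
  rw [norm_nablaSymbol]
  have h := le_norm_qSymbol s ξ q
  set p := 2 * Real.pi * ‖ξ‖
  -- After dropping `|Im s|²` this is `0 ≤ x² - a x + a²` up to nonnegative terms, with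
  -- `a = 2 |Re s| + 1`.
  have h1 : p ≤ ((p - |s.re|) ^ 2 + (‖s‖ ^ 2 - s.re ^ 2)) + (2 * |s.re| + 1) ^ 2 := by
    nlinarith [re_sq_le_norm_sq s, sq_nonneg (p - (2 * |s.re| + 1)), abs_nonneg s.re,
      sq_nonneg p]
  nlinarith [mul_le_mul_of_nonneg_right h1 (norm_nonneg q)]

theorem coeFn_combination (r t : ℝ) (z w u : L2H) :
    ∀ᵐ x, (z - r • w + t • u : L2H) x = z x - r • w x + t • u x := by
  filter_upwards [Lp.coeFn_add (z - r • w) (t • u), Lp.coeFn_sub z (r • w), Lp.coeFn_smul r w,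
    Lp.coeFn_smul t u] with x h1 h2 h3 h4
  rw [h1, Pi.add_apply, h2, Pi.sub_apply, h3, h4]
  rfl

theorem fourier_combination (r t : ℝ) (z w u : L2H) :
    (𝓕 (z - r • w + t • u) : L2H) = 𝓕 z - r • (𝓕 w : L2H) + t • (𝓕 u : L2H) := by
  rw [fourier_add_L2H, fourier_real_smul, ← fourier_real_smul r w]
  congr 1
  exact (Lp.fourierTransformₗᵢ R3 (Quaternion ℝ)).map_sub _ _

theorem aestronglyMeasurable_symbol_apply {F : R3 → Quaternion ℝ → Quaternion ℝ}
    (hF : Continuous fun p : R3 × Quaternion ℝ => F p.1 p.2) (g : L2H) :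
    AEStronglyMeasurable (fun ξ => F ξ (g ξ)) volume := by
  have hid : AEStronglyMeasurable (fun ξ : R3 => ξ) volume := continuous_id.aestronglyMeasurable
  have hpair := hid.prodMk (Lp.memLp g).aestronglyMeasurable
  exact hF.comp_aestronglyMeasurable hpair

/-- The operator `Q_s(∇)` with domain `D(∇²)` is unitarily equivalent to multiplication by `qSymbol s`
with its maximal domain. -/
theorem mem_graph_Q_nabla_iff_fourier (s : Quaternion ℝ) (u f : L2H) :
    (u, f) ∈ (Q s nabla).graph ↔ ∀ᵐ ξ, (𝓕 f : L2H) ξ = qSymbol s ξ ((𝓕 u : L2H) ξ) := by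
  rw [mem_graph_Q_iff]
  constructor
  · rintro ⟨w, z, hw, hz, rfl⟩
    rw [mem_graph_nabla_iff_fourier] at hw hz
    rw [fourier_combination]
    filter_upwards [hw, hz, coeFn_combination (2 * s.re) (‖s‖ ^ 2) (𝓕 z) (𝓕 w) (𝓕 u)]
      with ξ h1 h2 h3
    rw [h3, h2, h1, nablaSymbol_nablaSymbol, qSymbol, add_smul]
    abel
  · intro h
    -- The estimate gives `∇ u ∈ L²`; then `∇ (∇ u)` is found by solving the equation for it.
    have hmem : MemLp (fun ξ => nablaSymbol ξ ((𝓕 u : L2H) ξ)) 2 volume := by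
      refine ((Lp.memLp (𝓕 f : L2H)).norm.add
        ((Lp.memLp (𝓕 u : L2H)).norm.const_mul ((2 * |s.re| + 1) ^ 2))).of_le
        (aestronglyMeasurable_symbol_apply continuous_nablaSymbol (𝓕 u)) ?_
      filter_upwards [h] with ξ hξ
      refine le_trans ?_ (Real.le_norm_self _)
      simp only [Pi.add_apply, hξ]
      exact norm_nablaSymbol_le s ξ _
    obtain ⟨w, hw'⟩ := exists_fourier_ae_eq hmem
    refine ⟨w, f - (-(2 * s.re)) • w + (-‖s‖ ^ 2) • u, (mem_graph_nabla_iff_fourier _ _).2 hw',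
      (mem_graph_nabla_iff_fourier _ _).2 ?_, ?_⟩
    · rw [fourier_combination]
      filter_upwards [h, hw', coeFn_combination (-(2 * s.re)) (-‖s‖ ^ 2) (𝓕 f) (𝓕 w) (𝓕 u)]
        with ξ h1 h2 h3
      rw [h3, h1, h2, nablaSymbol_nablaSymbol, qSymbol]
      module
    · module

/-! ### Non-real points belong to the resolvent set -/

theorem norm_le_of_fourier {u f : L2H} {C : ℝ}
    (h : ∀ᵐ ξ, ‖(𝓕 u : L2H) ξ‖ ≤ C * ‖(𝓕 f : L2H) ξ‖) : ‖u‖ ≤ C * ‖f‖ := by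
  rw [← Lp.norm_fourier_eq u, ← Lp.norm_fourier_eq f]
  exact Lp.norm_le_mul_norm_of_ae_le_mul h

/-- The inverse of `qSymbol s ξ`: as the symbol `P` of `∇` satisfies `P² = p²` with `p = 2π|ξ|`, the
inverse of `p² + |s|² - 2 Re(s) P` is its conjugate `p² + |s|² + 2 Re(s) P` divided by their product,
a real number. -/
def qSymbolInv (s : Quaternion ℝ) (ξ : R3) (q : Quaternion ℝ) : Quaternion ℝ :=
  (((2 * Real.pi * ‖ξ‖) ^ 2 + ‖s‖ ^ 2) ^ 2 - (2 * s.re) ^ 2 * (2 * Real.pi * ‖ξ‖) ^ 2)⁻¹ •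
    (((2 * Real.pi * ‖ξ‖) ^ 2 + ‖s‖ ^ 2) • q + (2 * s.re) • nablaSymbol ξ q)

theorem qSymbol_det_pos {s : Quaternion ℝ} (hs : s.re ^ 2 < ‖s‖ ^ 2) (p : ℝ) :
    0 < (p ^ 2 + ‖s‖ ^ 2) ^ 2 - (2 * s.re) ^ 2 * p ^ 2 := by
  have h1 : 0 < p ^ 2 + ‖s‖ ^ 2 - 2 * s.re * p := by nlinarith [sq_nonneg (p - s.re)]
  have h2 : 0 < p ^ 2 + ‖s‖ ^ 2 + 2 * s.re * p := by nlinarith [sq_nonneg (p + s.re)]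
  calc 0 < _ := mul_pos h1 h2
    _ = _ := by ring

theorem qSymbol_qSymbolInv {s : Quaternion ℝ} (hs : s.re ^ 2 < ‖s‖ ^ 2) (ξ : R3)
    (q : Quaternion ℝ) : qSymbol s ξ (qSymbolInv s ξ q) = q := by
  have hd := qSymbol_det_pos hs (2 * Real.pi * ‖ξ‖)
  unfold qSymbol qSymbolInv
  set p := 2 * Real.pi * ‖ξ‖ with hp
  set d := (p ^ 2 + ‖s‖ ^ 2) ^ 2 - (2 * s.re) ^ 2 * p ^ 2
  have hinv : d⁻¹ • d • q = q := inv_smul_smul₀ hd.ne' q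
  rw [nablaSymbol_smul, nablaSymbol_add, nablaSymbol_smul, nablaSymbol_smul,
    nablaSymbol_nablaSymbol, ← hp]
  refine Eq.trans ?_ hinv
  simp only [d]
  module

theorem continuous_qSymbolInv {s : Quaternion ℝ} (hs : s.re ^ 2 < ‖s‖ ^ 2) :
    Continuous fun p : R3 × Quaternion ℝ => qSymbolInv s p.1 p.2 := by
  unfold qSymbolInv
  refine Continuous.smul (Continuous.inv₀ (by fun_prop) fun p => (qSymbol_det_pos hs _).ne') ?_
  have := continuous_nablaSymbol
  fun_prop

theorem hasBoundedInverse_Q_nabla {s : Quaternion ℝ} (hs : s.re ^ 2 < ‖s‖ ^ 2) :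
    HasBoundedInverse (Q s nabla) := by
  have hc : 0 < ‖s‖ ^ 2 - s.re ^ 2 := sub_pos.2 hs
  have hbound : ∀ ξ q, ‖q‖ ≤ (‖s‖ ^ 2 - s.re ^ 2)⁻¹ * ‖qSymbol s ξ q‖ := by
    intro ξ q
    rw [← div_eq_inv_mul, le_div_iff₀ hc, mul_comm]
    refine le_trans ?_ (le_norm_qSymbol s ξ q)
    gcongr
    exact le_add_of_nonneg_left (sq_nonneg _)
  refine hasBoundedInverse_of_graph (‖s‖ ^ 2 - s.re ^ 2)⁻¹ (fun f => ?_) fun u f huf => ?_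
  · have hmem : MemLp (fun ξ => qSymbolInv s ξ ((𝓕 f : L2H) ξ)) 2 volume := by
      refine ((Lp.memLp (𝓕 f : L2H)).norm.const_mul (‖s‖ ^ 2 - s.re ^ 2)⁻¹).of_le
        (aestronglyMeasurable_symbol_apply (continuous_qSymbolInv hs) (𝓕 f))
        (Eventually.of_forall fun ξ => ?_)
      refine le_trans (hbound ξ _) ?_
      rw [qSymbol_qSymbolInv hs]
      exact Real.le_norm_self _
    obtain ⟨u, hu⟩ := exists_fourier_ae_eq hmem
    refine ⟨u, (mem_graph_Q_nabla_iff_fourier s u f).2 ?_⟩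
    filter_upwards [hu] with ξ hξ
    rw [hξ, qSymbol_qSymbolInv hs]
  · rw [mem_graph_Q_nabla_iff_fourier] at huf
    refine norm_le_of_fourier ?_
    filter_upwards [huf] with ξ hξ
    rw [hξ]
    exact hbound ξ _

/-! ### Real points belong to the spectrum -/

/-- For real `r`, the operator `Q_r(∇)` is not bounded below. -/
theorem exists_approximate_kernel (r : ℝ) {ε : ℝ} (hε : 0 < ε) :
    ∃ u f : L2H, (u, f) ∈ (Q (r : Quaternion ℝ) nabla).graph ∧ u ≠ 0 ∧ ‖f‖ ≤ ε * ‖u‖ := by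
  -- At `ξ₀` the symbol of `∇` maps `1` to `2π (-r / 2π) e₁ e₁ = r`.
  set ξ₀ : R3 := EuclideanSpace.single 0 (-r / (2 * Real.pi)) with hξ₀
  have hcont : Continuous fun ξ => qSymbol (r : Quaternion ℝ) ξ 1 := by
    unfold qSymbol nablaSymbol vec
    fun_prop
  have hzero : qSymbol (r : Quaternion ℝ) ξ₀ 1 = 0 := by
    have h1 : nablaSymbol ξ₀ 1 = (r : Quaternion ℝ) := by
      have hpi := Real.pi_ne_zero
      ext <;> simp [nablaSymbol, vec, hξ₀]
      field_simp
    have h2 : (2 * Real.pi * ‖ξ₀‖) ^ 2 = r ^ 2 := by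
      rw [hξ₀, PiLp.norm_single, mul_pow, Real.norm_eq_abs, sq_abs]
      field_simp
    rw [qSymbol, h1, h2, Quaternion.norm_coe, Real.norm_eq_abs, sq_abs, Quaternion.re_coe,
      ← mul_one (r : Quaternion ℝ), Quaternion.coe_mul_eq_smul]
    module
  obtain ⟨δ, hδ, hball⟩ := Metric.continuous_iff.1 hcont ξ₀ ε hε
  have hsmall : ∀ ξ ∈ Metric.ball ξ₀ δ, ‖qSymbol (r : Quaternion ℝ) ξ 1‖ ≤ ε := by
    intro ξ hξ
    have h := hball ξ hξ
    rw [hzero, dist_zero_right] at h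
    exact h.le
  have hfin : volume (Metric.ball ξ₀ δ) ≠ ⊤ := measure_ball_lt_top.ne
  set g : L2H := indicatorConstLp 2 measurableSet_ball hfin (1 : Quaternion ℝ) with hg
  have hgae : ∀ᵐ ξ, g ξ = (Metric.ball ξ₀ δ).indicator (fun _ => 1) ξ := indicatorConstLp_coeFn
  have hle : ∀ᵐ ξ, ‖qSymbol (r : Quaternion ℝ) ξ (g ξ)‖ ≤ ε * ‖g ξ‖ := by
    filter_upwards [hgae] with ξ hξ
    rw [hξ]
    by_cases hmem : ξ ∈ Metric.ball ξ₀ δ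
    · simpa [Set.indicator_of_mem hmem] using hsmall ξ hmem
    · simp [Set.indicator_of_notMem hmem, qSymbol, nablaSymbol]
  have hmeas : AEStronglyMeasurable (fun ξ => qSymbol (r : Quaternion ℝ) ξ (g ξ)) volume := by
    have hq : Continuous fun p : R3 × Quaternion ℝ => qSymbol (r : Quaternion ℝ) p.1 p.2 := by
      unfold qSymbol nablaSymbol vec
      fun_prop
    exact aestronglyMeasurable_symbol_apply hq g
  have hmemLp : MemLp (fun ξ => qSymbol (r : Quaternion ℝ) ξ (g ξ)) 2 volume :=
    (Lp.memLp g).of_le_mul hmeas hle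
  obtain ⟨u, hu⟩ := fourier_surjective g
  obtain ⟨f, hfae⟩ := exists_fourier_ae_eq hmemLp
  refine ⟨u, f, ?_, ?_, ?_⟩
  · rw [mem_graph_Q_nabla_iff_fourier, hu]
    exact hfae
  · rw [← norm_ne_zero_iff, ← Lp.norm_fourier_eq u, hu, hg,
      norm_indicatorConstLp (by norm_num) (by norm_num)]
    have hpos : 0 < volume.real (Metric.ball ξ₀ δ) :=
      ENNReal.toReal_pos (Metric.measure_ball_pos volume ξ₀ hδ).ne' hfin
    rw [norm_one, one_mul]
    positivity
  · refine norm_le_of_fourier ?_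
    filter_upwards [hfae, hle] with ξ h1 h2
    rw [h1, hu]
    exact h2

theorem not_hasBoundedInverse_Q_nabla (r : ℝ) :
    ¬ HasBoundedInverse (Q (r : Quaternion ℝ) nabla) := by
  intro h
  obtain ⟨C, hC0, hC⟩ := h.exists_bound
  obtain ⟨u, f, huf, hu, hle⟩ :=
    exists_approximate_kernel r (inv_pos.2 (by positivity : 0 < C + 1))
  have hpos := norm_pos_iff.2 hu
  have h1 : ‖u‖ ≤ C * ((C + 1)⁻¹ * ‖u‖) :=
    (hC u f huf).trans (mul_le_mul_of_nonneg_left hle hC0)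
  have h2 : C * ((C + 1)⁻¹ * ‖u‖) < ‖u‖ := by
    rw [← mul_assoc, ← div_eq_mul_inv]
    exact mul_lt_of_lt_one_left hpos ((div_lt_one (by positivity)).2 (lt_add_one C))
  exact absurd h1 (not_le.2 h2)

theorem re_sq_lt_norm_sq {s : Quaternion ℝ}
    (hs : s ∉ Set.range fun r : ℝ => (r : Quaternion ℝ)) : s.re ^ 2 < ‖s‖ ^ 2 := by
  refine lt_of_le_of_ne (re_sq_le_norm_sq s) fun h => hs ⟨s.re, ?_⟩
  rw [norm_sq_quaternion] at h
  ext
  · simp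
  · simp only [Quaternion.imI_coe]
    nlinarith [sq_nonneg s.imI, sq_nonneg s.imJ, sq_nonneg s.imK]
  · simp only [Quaternion.imJ_coe]
    nlinarith [sq_nonneg s.imI, sq_nonneg s.imJ, sq_nonneg s.imK]
  · simp only [Quaternion.imK_coe]
    nlinarith [sq_nonneg s.imI, sq_nonneg s.imJ, sq_nonneg s.imK]

end QuaternionicNabla

end

theorem mainTheorem8 :
    QuaternionicNabla.sSpectrum QuaternionicNabla.nabla =
      Set.range (fun r : ℝ => (r : Quaternion ℝ)) := by
  ext s
  constructor
  · intro hs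
    by_contra h
    exact hs (QuaternionicNabla.hasBoundedInverse_Q_nabla (QuaternionicNabla.re_sq_lt_norm_sq h))
  · rintro ⟨r, rfl⟩
    exact QuaternionicNabla.not_hasBoundedInverse_Q_nabla r
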